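/- Let $n\ge 0$, let $X\cong\mathbb Z^n$ be the weight lattice of $SL_{n+1}(\mathbb C)$, with simple roots $\alpha_1,\dots,\alpha_n$, positive roots $\Phi_+=\{\alpha_{j,k}=\alpha_j+\dots+\alpha_k : 1\le j\le k\le n\}$, Weyl group $W=\langle s_1,\dots,s_n\rangle$, and $\rho^\vee$ half the sum of the positive coroots. Let $\lambda\in X$ be dominant and let $\mathcal B(\lambda)$ be the crystal of the irreducible representation of highest weight $\lambda$, with crystal operators $e_i,f_i$ and weight function $\mathrm{wt}$. The group $W$ acts on $\mathcal B(\lambda)$, the simple reflection $s_i$ reversing each $\alpha_i$-string. For $\alpha=\alpha_{j,k}\in\Phi_+$ put $e_\alpha=w e_k w^{-1}$ with $w=s_js_{j+1}\cdots s_{k-1}$, and $\varepsilon_\alpha(T)=\max\{N : e_\alpha^N(T)\ne 0\}$. The atomic number of $T\in\mathcal B(\lambda)$ is $$Z(T)=\langle \mathrm{wt}(T),\rho^\vee\rangle+\sum_{\alpha\in\Phi_+}\varepsilon_\alpha(T)\in\tfrac12\mathbb Z .$$ For $\alpha\in\Phi_+$ put $\tilde f_\alpha=wf_nw^{-1}$,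 where $w\in W$ is such that $w(\alpha_n)=\alpha$ (the operator does not depend on the choice of $w$). Let $\mathbb B^+(\lambda)$ be the graph whose vertices are the $T\in\mathcal B(\lambda)$ of dominant weight, with an edge between $T$ and $T'$ if $\tilde f_\alpha(T')=T$ for some $\alpha\in\Phi_+$. For $T\in\mathcal B(\lambda)$ let $\bar T$ be the unique element of dominant weight in the orbit $W\cdot T$. The LL atoms of $\mathcal B(\lambda)$ are the classes of the equivalence relation "$\bar T$ and $\bar T'$ lie in the same connected component of $\mathbb B^+(\lambda)$". Then $Z$ is constant on each LL atom of $\mathcal B(\lambda)$. Moreover, $Z$ is constant on each connected component of the graph $\mathbb B_1(\lambda)$ with vertex set $\mathcal B(\lambda)$ in which $T$ and $T'$ are joined if $T=w(T')$ for some $w\in W$ or $T=f_n(T')$. (For $n=0$ there is no $f_n$, and the claim is trivial.) -/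

import Mathlib

namespace TypeACrystal

/-! ### Weights and roots of type `A_n`

The character lattice `X` of the maximal torus of `SL_{n+1}` is identified with `ℤⁿ` through the
basis of fundamental weights: the coordinate `μ i` is the pairing of `μ` with the simple coroot
number `i`. Simple roots are indexed by `Fin n`, so that `0, …, n - 1` stand for `1, …, n`. -/

/-- The weight lattice in fundamental-weight coordinates. -/
abbrev Weight (n : ℕ) : Type := Fin n → ℤ

/-- The dominant weights `X₊`. -/
def IsDominant {n : ℕ} (μ : Weight n) : Prop := ∀ i, 0 ≤ μ i

/-- The simple root `α_i`: its pairings with the simple coroots form a column of the Cartan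
matrix `(⟨α_i, α_j^∨⟩)`. -/
def simpleRoot {n : ℕ} (i : Fin n) : Weight n :=
  fun j => CartanMatrix.A n j i

/-- The root `α_{j,k} = α_j + ⋯ + α_k`. For `j ≤ k` these are exactly the positive roots. -/
def root {n : ℕ} (j k : Fin n) : Weight n := ∑ i ∈ Finset.Icc j k, simpleRoot i

/-- The index set of the positive roots: the pairs `(j, k)` with `j ≤ k`. -/
def posRoots (n : ℕ) : Finset (Fin n × Fin n) := Finset.univ.filter fun p => p.1 ≤ p.2

/-- The pairing of a weight with the coroot `α_{j,k}^∨ = α_j^∨ + ⋯ + α_k^∨`. -/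
def corootPairing {n : ℕ} (μ : Weight n) (j k : Fin n) : ℤ := ∑ i ∈ Finset.Icc j k, μ i

/-- The pairing with `ρ^∨`, half the sum of the positive coroots. It may be a half-integer. -/
def rhoPairing {n : ℕ} (μ : Weight n) : ℚ :=
  (1 / 2 : ℚ) * ∑ p ∈ posRoots n, (corootPairing μ p.1 p.2 : ℚ)

/-- The simple reflection `s_i` on `X`, namely `μ ↦ μ - ⟨μ, α_i^∨⟩ α_i`. -/
def reflect {n : ℕ} (i : Fin n) (μ : Weight n) : Weight n := μ - μ i • simpleRoot i

/-- The action on `X` of the Weyl group element `s_{i₁} ⋯ s_{i_r}` given by a list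
`[i₁, …, i_r]`. -/
def weylWeight {n : ℕ} (l : List (Fin n)) (μ : Weight n) : Weight n := l.foldr reflect μ

/-! ### The crystal `B(λ)`

The crystal of the natural representation has the vertices `0, …, n`, with an `i`-arrow from `i` to
`i + 1` (the vectors `i.castSucc` and `i.succ` for `i : Fin n`). Words `x₁ ⋯ x_N` are the vertices
`x₁ ⊗ ⋯ ⊗ x_N` of its `N`-th tensor power, with Kashiwara's tensor product rule
(`f_i (b ⊗ b')` is `f_i b ⊗ b'` if `φ_i b > ε_i b'` and `b ⊗ f_i b'` otherwise;
`e_i (b ⊗ b')` is `e_i b ⊗ b'` if `φ_i b ≥ ε_i b'` and `b ⊗ e_i b'` otherwise).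
`B(λ)` is the connected component of a highest weight vertex of weight `λ`. The value `none` is
the zero of the crystal operators. -/

/-- Vertices of the tensor powers of the crystal of the natural representation. -/
abbrev Word (n : ℕ) : Type := List (Fin (n + 1))

/-- `φ_i` of a single letter. -/
def letterPhi {n : ℕ} (i : Fin n) (x : Fin (n + 1)) : ℕ := if x = i.castSucc then 1 else 0

/-- `ε_i` of a single letter. -/
def letterEps {n : ℕ} (i : Fin n) (x : Fin (n + 1)) : ℕ := if x = i.succ then 1 else 0

/-- `ε_i` of a word, by the tensor product rule
`ε_i (b ⊗ b') = ε_i b + max 0 (ε_i b' - φ_i b)` (the subtraction is truncated). -/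
def wordEps {n : ℕ} (i : Fin n) : Word n → ℕ
  | [] => 0
  | x :: w => letterEps i x + (wordEps i w - letterPhi i x)

/-- The crystal operator `f_i`. -/
def f {n : ℕ} (i : Fin n) : Word n → Option (Word n)
  | [] => none
  | x :: w =>
    if wordEps i w < letterPhi i x then
      (if x = i.castSucc then some (i.succ :: w) else none)
    else (f i w).map fun v => x :: v

/-- The crystal operator `e_i`. -/
def e {n : ℕ} (i : Fin n) : Word n → Option (Word n)
  | [] => none
  | x :: w =>
    if wordEps i w ≤ letterPhi i x then
      (if x = i.succ then some (i.castSucc :: w) else none)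
    else (e i w).map fun v => x :: v

/-- The weight of a word: the letter `x` has the weight of the `x`-th standard basis vector. -/
def wt {n : ℕ} (T : Word n) : Weight n :=
  fun i => (T.count i.castSucc : ℤ) - (T.count i.succ : ℤ)

/-- The highest weight vertex of weight `λ = ∑ λ_i ϖ_i`: the word `0^{p_0} 1^{p_1} ⋯` in which
`p_i = λ_i + λ_{i+1} + ⋯` are the parts of the partition of `λ`. -/
def highestWord {n : ℕ} (lam : Weight n) : Word n :=
  (List.finRange n).flatMap fun i =>
    List.replicate (∑ k ∈ Finset.Ici i, (lam k).toNat) i.castSucc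

/-- Membership in `B(λ)` (for dominant `λ`): the smallest set that contains the highest weight
vertex and is stable under all crystal operators. -/
inductive InCrystal {n : ℕ} (lam : Weight n) : Word n → Prop
  | highest : InCrystal lam (highestWord lam)
  | lower {T T' : Word n} (i : Fin n) : InCrystal lam T → f i T = some T' → InCrystal lam T'
  | raise {T T' : Word n} (i : Fin n) : InCrystal lam T → e i T = some T' → InCrystal lam T'

/-- The crystal `B(λ)`. -/
def crystal {n : ℕ} (lam : Weight n) : Set (Word n) := {T | InCrystal lam T}

/-! ### The Weyl group action and the modified crystal operators -/

/-- The `N`-fold iterate of a partial operator. -/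
def iter {B : Type} (g : B → Option B) (N : ℕ) (T : B) : Option B :=
  (fun o : Option B => o.bind g)^[N] (some T)

/-- `max {N | g^N (T) ≠ 0}`. -/
noncomputable def stringLength {B : Type} (g : B → Option B) (T : B) : ℕ :=
  sSup {N : ℕ | iter g N T ≠ none}

/-- The simple reflection `s_i` on the crystal, which reverses the `α_i`-strings: an element with
`ε` elements above it and `φ` below it in its string goes to the one with `φ` above and `ε` below.
(The default value in `getD` is never used.) -/
noncomputable def s {n : ℕ} (i : Fin n) (T : Word n) : Word n :=
  if stringLength (e i) T ≤ stringLength (f i) T then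
    (iter (f i) (stringLength (f i) T - stringLength (e i) T) T).getD T
  else
    (iter (e i) (stringLength (e i) T - stringLength (f i) T) T).getD T

/-- The action on the crystal of the Weyl group element `s_{i₁} ⋯ s_{i_r}` given by a list
`[i₁, …, i_r]`. -/
noncomputable def weyl {n : ℕ} (l : List (Fin n)) (T : Word n) : Word n := l.foldr s T

/-- The conjugate `w g w⁻¹` of a partial operator `g` by `w = s_{i₁} ⋯ s_{i_r}`, where
`w⁻¹ = s_{i_r} ⋯ s_{i₁}`. -/
noncomputable def conj {n : ℕ} (l : List (Fin n)) (g : Word n → Option (Word n)) (T : Word n) :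
    Option (Word n) :=
  (g (weyl l.reverse T)).map (weyl l)

/-- The list `[j, j+1, …, k-1]`, that is, the Weyl group element `s_j s_{j+1} ⋯ s_{k-1}`. -/
def chain {n : ℕ} (j k : Fin n) : List (Fin n) :=
  (List.finRange n).filter fun i => j ≤ i ∧ i < k

/-- The modified crystal operator `e_α = w e_k w⁻¹` for `α = α_{j,k}`, `w = s_j ⋯ s_{k-1}`. -/
noncomputable def eRoot {n : ℕ} (j k : Fin n) : Word n → Option (Word n) :=
  conj (chain j k) (e k)

/-- `ε_α` for `α = α_{j,k}`. -/
noncomputable def epsRoot {n : ℕ} (j k : Fin n) (T : Word n) : ℕ := stringLength (eRoot j k) T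

/-- The atomic number `Z(T) = ⟨wt T, ρ^∨⟩ + ∑_{α ∈ Φ₊} ε_α(T)`. -/
noncomputable def atomicNumber {n : ℕ} (T : Word n) : ℚ :=
  rhoPairing (wt T) + ∑ p ∈ posRoots n, (epsRoot p.1 p.2 T : ℚ)

/-! ### LL atoms -/

/-- `T` and `T'` lie in the same orbit of the Weyl group (which is generated by the `s_i`). -/
def SameOrbit {n : ℕ} (T T' : Word n) : Prop := ∃ l : List (Fin n), T = weyl l T'

/-- `T = f̃_α(T')` for `α = α_{j,k}`, where `f̃_α = w f_n w⁻¹` for a Weyl group element `w` with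
`w(α_n) = α`. -/
def IsTildeF {n : ℕ} (j k : Fin n) (T' T : Word n) : Prop :=
  ∃ (l : List (Fin n)) (m : Fin n), (m : ℕ) + 1 = n ∧
    weylWeight l (simpleRoot m) = root j k ∧ conj l (f m) T' = some T

/-- The edges of the graph `𝔹⁺(λ)` on the elements of `B(λ)` of dominant weight. -/
def DominantEdge {n : ℕ} (lam : Weight n) (T T' : Word n) : Prop :=
  (T ∈ crystal lam ∧ IsDominant (wt T)) ∧ (T' ∈ crystal lam ∧ IsDominant (wt T')) ∧
    ∃ p ∈ posRoots n, IsTildeF p.1 p.2 T' T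

/-- `D = T̄`: the element of dominant weight in the Weyl group orbit of `T`. -/
def IsDominantRep {n : ℕ} (T D : Word n) : Prop := SameOrbit D T ∧ IsDominant (wt D)

/-- LL-equivalence: `T̄` and `T̄'` lie in the same connected component of `𝔹⁺(λ)`. -/
def LLEquiv {n : ℕ} (lam : Weight n) (T T' : Word n) : Prop :=
  ∃ D D' : Word n, IsDominantRep T D ∧ IsDominantRep T' D' ∧
    Relation.EqvGen (DominantEdge lam) D D'

/-- The LL atoms of `B(λ)`: the classes of LL-equivalence. -/
def IsLLAtom {n : ℕ} (lam : Weight n) (A : Set (Word n)) : Prop :=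
  ∃ T₀ ∈ crystal lam, A = {T | T ∈ crystal lam ∧ LLEquiv lam T₀ T}

/-- The edges of the graph `𝔹₁(λ)` on `B(λ)`: `T = w(T')` with `w` in the Weyl group, or
`T = f_n(T')`. -/
def OrbitEdge {n : ℕ} (lam : Weight n) (T T' : Word n) : Prop :=
  T ∈ crystal lam ∧ T' ∈ crystal lam ∧
    (SameOrbit T T' ∨ ∃ m : Fin n, (m : ℕ) + 1 = n ∧ f m T' = some T)

/-- The connected components of `𝔹₁(λ)`, that is, the closures of the Weyl group orbits
under `f_n`. -/
def IsOrbitComponent {n : ℕ} (lam : Weight n) (A : Set (Word n)) : Prop :=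
  ∃ T₀ ∈ crystal lam, A = {T | T ∈ crystal lam ∧ Relation.EqvGen (OrbitEdge lam) T₀ T}

end TypeACrystal

/-!
For a positive root `α = α_{j,k}` let `ℓ_α(T) = ε_α(T) + φ_α(T)` be the length of the `α`-string
through `T`, that is, the length of the `k`-string through `s_{k-1} ⋯ s_j (T)`. As `⟨wt T, α^∨⟩ =
φ_α(T) - ε_α(T)`, the atomic number is half the sum of all `ℓ_α(T)` (`atomicNumber_eq`). The claim
follows once this sum is invariant under the simple reflections and under `f_n`, on all words:
LL-equivalence and the graph `𝔹₁(λ)` use nothing else.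

Let `G_k` be the sum of the `ℓ_{α_{j,k}}` over `j ≤ k`.

* For `i < k` the reflection `s_i` permutes the terms of `G_k` (`stringSum_s`). It exchanges the
  terms for `j = i` and `j = i + 1` and fixes the others. For `j < i` this needs the braid relation
  `s_braid`.
* The sum `G_1 + ⋯ + G_i` is constant along `f_i` (`sum_Iic_stringSum_f`), hence invariant under
  `s_i`. The terms `G_k` with `k < i - 1` involve only operators that commute with `f_i`. In
  `G_{i-1} + G_i` the term of `α_i` is the length of the `i`-string, and the terms of `α_{j,i-1}`
  and `α_{j,i}` are paired: since `s_j, …, s_{i-2}` commute with `f_i`, their sum is constant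
  because `ℓ_{i-1}(T) + ℓ_i(s_{i-1} T)` is constant along `f_i` (`ell_add_ell_f`).

So `s_i` preserves `G_1 + ⋯ + G_i` and each later `G_k`, and `f_n` preserves `G_1 + ⋯ + G_n`.

The braid relation and the last identity concern three consecutive letters. Row insertion is an
injective map from words to pairs of a three-letter tableau and recording data. The crystal
operators act on the tableau alone, and there they have explicit piecewise linear formulas, from
which both facts are checked by linear arithmetic. For commuting operators `f_i`, `f_k` the role of
insertion is played by the two maps that identify the letters moved by `f_i`, respectively by `f_k`:
each forgets one of the operators and keeps the other, and together they are injective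
(`merge_injective`).
-/

namespace TypeACrystal

/-! ### Partial operators and string reversal -/

section Strings

variable {B C : Type}

theorem iter_zero (g : B → Option B) (T : B) : iter g 0 T = some T := rfl

theorem iter_succ (g : B → Option B) (N : ℕ) (T : B) : iter g (N + 1) T = (iter g N T).bind g := by
  simp only [iter, Function.iterate_succ_apply']

theorem iter_succ' (g : B → Option B) (N : ℕ) (T : B) :
    iter g (N + 1) T = (g T).bind (iter g N) := by
  induction N with
  | zero => cases h : g T <;> simp [iter, h]
  | succ N ih => rw [iter_succ, ih, Option.bind_assoc]; simp only [← iter_succ]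

theorem iter_ne_none_iff {g : B → Option B} {p : B → ℕ} (h0 : ∀ T, g T = none → p T = 0)
    (hs : ∀ T T', g T = some T' → p T = p T' + 1) (N : ℕ) (T : B) :
    iter g N T ≠ none ↔ N ≤ p T := by
  induction N generalizing T with
  | zero => simp [iter_zero]
  | succ N ih =>
    rw [iter_succ']
    cases h : g T with
    | none => simp [h0 T h]
    | some T' => rw [Option.bind_some, ih, hs T T' h]; omega

/-- A function that drops by one along `g`, and vanishes where `g` does, is the string length. -/
theorem stringLength_eq {g : B → Option B} {p : B → ℕ} (h0 : ∀ T, g T = none → p T = 0)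
    (hs : ∀ T T', g T = some T' → p T = p T' + 1) (T : B) : stringLength g T = p T := by
  have : {N : ℕ | iter g N T ≠ none} = Set.Iic (p T) := by
    ext N; exact iter_ne_none_iff h0 hs N T
  rw [stringLength, this]
  exact csSup_Iic

theorem iter_map {g : B → Option B} {g' : C → Option C} {P : B → C}
    (h : ∀ T, (g T).map P = g' (P T)) (N : ℕ) (T : B) :
    (iter g N T).map P = iter g' N (P T) := by
  induction N with
  | zero => rfl
  | succ N ih =>
    rw [iter_succ, iter_succ, ← ih]
    cases iter g N T <;> simp [h]

theorem stringLength_map {g : B → Option B} {g' : C → Option C} {P : B → C}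
    (h : ∀ T, (g T).map P = g' (P T)) (T : B) : stringLength g T = stringLength g' (P T) := by
  simp only [stringLength, ← iter_map h, ne_eq, Option.map_eq_none_iff]

theorem iter_invariant {X : Type} {g : B → Option B} {F : B → X}
    (h : ∀ T T', g T = some T' → F T' = F T) (N : ℕ) (T T' : B) (hT : iter g N T = some T') :
    F T' = F T := by
  induction N generalizing T with
  | zero => cases hT; rfl
  | succ N ih =>
    rw [iter_succ'] at hT
    obtain ⟨U, hU, hU'⟩ := Option.bind_eq_some_iff.1 hT
    rw [ih U hU', h T U hU]

/-- The reversal of the strings of a pair of partial operators, as in the definition of `s`. -/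
noncomputable def reversal (e f : B → Option B) (T : B) : B :=
  if stringLength e T ≤ stringLength f T then
    (iter f (stringLength f T - stringLength e T) T).getD T
  else
    (iter e (stringLength e T - stringLength f T) T).getD T

theorem reversal_map {e f : B → Option B} {e' f' : C → Option C} {P : B → C}
    (he : ∀ T, (e T).map P = e' (P T)) (hf : ∀ T, (f T).map P = f' (P T)) (T : B) :
    P (reversal e f T) = reversal e' f' (P T) := by
  simp only [reversal, ← stringLength_map he, ← stringLength_map hf, ← iter_map he, ← iter_map hf]
  split_ifs <;> rw [Option.getD_map]

theorem reversal_invariant {X : Type} {e f : B → Option B} {F : B → X}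
    (he : ∀ T T', e T = some T' → F T' = F T) (hf : ∀ T T', f T = some T' → F T' = F T) (T : B) :
    F (reversal e f T) = F T := by
  unfold reversal
  split_ifs
  · cases h : iter f (stringLength f T - stringLength e T) T with
    | none => rfl
    | some T' => exact iter_invariant hf _ _ _ h
  · cases h : iter e (stringLength e T - stringLength f T) T with
    | none => rfl
    | some T' => exact iter_invariant he _ _ _ h

/-- Iterating `g`, with inverse `g'`, transports `N` steps from the string length of `g` to that of
`g'`. -/
theorem iter_eq_some {g g' : B → Option B} {p q : B → ℕ}
    (hp : ∀ T, g T = none → p T = 0)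
    (h : ∀ T T', g T = some T' → p T = p T' + 1 ∧ q T' = q T + 1 ∧ g' T' = some T)
    (N : ℕ) (T : B) (hN : N ≤ p T) :
    ∃ T', iter g N T = some T' ∧ p T = p T' + N ∧ q T' = q T + N ∧ iter g' N T' = some T := by
  induction N with
  | zero => exact ⟨T, rfl, rfl, rfl, rfl⟩
  | succ N ih =>
    obtain ⟨U, hU, hp1, hq1, hU'⟩ := ih (by omega)
    cases hg : g U with
    | none => have := hp U hg; omega
    | some V =>
      obtain ⟨h1, h2, h3⟩ := h U V hg
      exact ⟨V, by rw [iter_succ, hU, Option.bind_some, hg], by omega, by omega,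
        by rw [iter_succ', h3, Option.bind_some, hU']⟩

theorem reversal_spec {e f : B → Option B} {ε φ : B → ℕ}
    (hε : ∀ T, e T = none → ε T = 0) (hφ : ∀ T, f T = none → φ T = 0)
    (he : ∀ T T', e T = some T' → ε T = ε T' + 1 ∧ φ T' = φ T + 1 ∧ f T' = some T)
    (hf : ∀ T T', f T = some T' → φ T = φ T' + 1 ∧ ε T' = ε T + 1 ∧ e T' = some T) (T : B) :
    ε (reversal e f T) = φ T ∧ φ (reversal e f T) = ε T ∧ reversal e f (reversal e f T) = T := by
  have hE : ∀ T, stringLength e T = ε T := stringLength_eq hε fun T T' h => (he T T' h).1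
  have hF : ∀ T, stringLength f T = φ T := stringLength_eq hφ fun T T' h => (hf T T' h).1
  simp only [reversal, hE, hF]
  rcases lt_trichotomy (ε T) (φ T) with h | h | h
  · obtain ⟨U, hU, h1, h2, h3⟩ := iter_eq_some hφ hf (φ T - ε T) T (by omega)
    have e1 : ε U = φ T := by omega
    have e2 : φ U = ε T := by omega
    simp [h.le, hU, e1, e2, h.not_ge, h3]
  · simp [h, iter_zero]
  · obtain ⟨U, hU, h1, h2, h3⟩ := iter_eq_some hε he (ε T - φ T) T (by omega)
    have e1 : ε U = φ T := by omega
    have e2 : φ U = ε T := by omega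
    simp [h.le, hU, e1, e2, h.not_ge, h3]

end Strings

/-! ### Crystal operators on words -/

section Words

variable {n : ℕ}

/-- `φ_i` of a word, by the tensor product rule `φ_i (b ⊗ b') = φ_i b' + max 0 (φ_i b - ε_i b')`. -/
def wordPhi (i : Fin n) : Word n → ℕ
  | [] => 0
  | x :: w => wordPhi i w + (letterPhi i x - wordEps i w)

theorem letterPhi_castSucc (i : Fin n) : letterPhi i i.castSucc = 1 := by simp [letterPhi]
theorem letterEps_succ (i : Fin n) : letterEps i i.succ = 1 := by simp [letterEps]
theorem castSucc_ne_succ (i : Fin n) : i.castSucc ≠ i.succ := by simp [Fin.ext_iff]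
theorem letterPhi_succ (i : Fin n) : letterPhi i i.succ = 0 := by
  simp [letterPhi, (castSucc_ne_succ i).symm]
theorem letterEps_castSucc (i : Fin n) : letterEps i i.castSucc = 0 := by
  simp [letterEps, castSucc_ne_succ i]

theorem wordPhi_eq_zero_of_f_eq_none (i : Fin n) (T : Word n) (h : f i T = none) :
    wordPhi i T = 0 := by
  induction T with
  | nil => rfl
  | cons x w ih =>
    simp only [f] at h
    simp only [wordPhi]
    by_cases hx : x = i.castSucc
    · subst hx
      simp only [letterPhi_castSucc, if_true] at h ⊢
      split_ifs at h with h1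
      rw [ih (by simpa using h)]; omega
    · have : letterPhi i x = 0 := by simp [letterPhi, hx]
      simp only [this, not_lt_zero, if_false, Option.map_eq_none_iff] at h ⊢
      rw [ih h, Nat.zero_sub]

theorem wordEps_eq_zero_of_e_eq_none (i : Fin n) (T : Word n) (h : e i T = none) :
    wordEps i T = 0 := by
  induction T with
  | nil => rfl
  | cons x w ih =>
    simp only [e] at h
    simp only [wordEps]
    by_cases hx : x = i.succ
    · subst hx
      simp only [letterPhi_succ, if_true] at h ⊢
      split_ifs at h with h1
      have := ih (by simpa using h)
      omega
    · have : letterEps i x = 0 := by simp [letterEps, hx]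
      simp only [this, hx, if_false] at h ⊢
      split_ifs at h with h1
      · omega
      · have := ih (by simpa using h)
        omega

theorem f_spec (i : Fin n) (T T' : Word n) (h : f i T = some T') :
    wordPhi i T = wordPhi i T' + 1 ∧ wordEps i T' = wordEps i T + 1 ∧ e i T' = some T := by
  induction T generalizing T' with
  | nil => simp [f] at h
  | cons x w ih =>
    simp only [f] at h
    split_ifs at h with h1 h2
    · cases h
      subst h2
      simp only [letterPhi_castSucc] at h1
      simp only [wordPhi, wordEps, e, letterPhi_castSucc, letterPhi_succ, letterEps_succ,
        letterEps_castSucc]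
      refine ⟨by omega, by omega, ?_⟩
      simp only [if_true]; rw [if_pos (by omega)]
    · obtain ⟨v, hv, rfl⟩ := Option.map_eq_some_iff.1 h
      obtain ⟨h3, h4, h5⟩ := ih v hv
      simp only [wordPhi, wordEps, e]
      refine ⟨by omega, by omega, ?_⟩
      rw [if_neg (by omega), h5]; rfl

theorem e_spec (i : Fin n) (T T' : Word n) (h : e i T = some T') :
    wordEps i T = wordEps i T' + 1 ∧ wordPhi i T' = wordPhi i T + 1 ∧ f i T' = some T := by
  induction T generalizing T' with
  | nil => simp [e] at h
  | cons x w ih =>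
    simp only [e] at h
    split_ifs at h with h1 h2
    · cases h
      subst h2
      simp only [letterPhi_succ] at h1
      simp only [wordPhi, wordEps, f, letterPhi_castSucc, letterPhi_succ, letterEps_succ,
        letterEps_castSucc]
      refine ⟨by omega, by omega, ?_⟩
      simp only [if_true]; rw [if_pos (by omega)]
    · obtain ⟨v, hv, rfl⟩ := Option.map_eq_some_iff.1 h
      obtain ⟨h3, h4, h5⟩ := ih v hv
      simp only [wordPhi, wordEps, f]
      refine ⟨by omega, by omega, ?_⟩
      rw [if_neg (by omega), h5]; rfl

theorem stringLength_e (i : Fin n) (T : Word n) : stringLength (e i) T = wordEps i T :=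
  stringLength_eq (wordEps_eq_zero_of_e_eq_none i) (fun T T' h => (e_spec i T T' h).1) T

theorem stringLength_f (i : Fin n) (T : Word n) : stringLength (f i) T = wordPhi i T :=
  stringLength_eq (wordPhi_eq_zero_of_f_eq_none i) (fun T T' h => (f_spec i T T' h).1) T

theorem s_eq_reversal (i : Fin n) : s i = reversal (e i) (f i) := rfl

theorem s_spec (i : Fin n) (T : Word n) :
    wordEps i (s i T) = wordPhi i T ∧ wordPhi i (s i T) = wordEps i T ∧ s i (s i T) = T :=
  reversal_spec (wordEps_eq_zero_of_e_eq_none i) (wordPhi_eq_zero_of_f_eq_none i)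
    (e_spec i) (f_spec i) T

theorem s_s (i : Fin n) (T : Word n) : s i (s i T) = T := (s_spec i T).2.2

/-- What is constant along `f_i` is invariant under `s_i`. -/
theorem s_invariant {X : Type} {i : Fin n} {F : Word n → X}
    (h : ∀ T T', f i T = some T' → F T' = F T) (T : Word n) : F (s i T) = F T :=
  reversal_invariant (fun T T' hT => (h T' T (e_spec i T T' hT).2.2).symm) h T

/-! ### Weights of words -/

theorem wordPhi_add_count (i : Fin n) (T : Word n) :
    wordPhi i T + T.count i.succ = wordEps i T + T.count i.castSucc := by
  induction T with
  | nil => rfl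
  | cons x w ih =>
    simp only [wordPhi, wordEps, List.count_cons, letterPhi, letterEps, beq_iff_eq]
    split_ifs <;> omega

theorem f_count (i : Fin n) (T T' : Word n) (h : f i T = some T') (x : Fin (n + 1)) :
    T'.count x + (if x = i.castSucc then 1 else 0) = T.count x + (if x = i.succ then 1 else 0) := by
  induction T generalizing T' with
  | nil => simp [f] at h
  | cons y w ih =>
    simp only [f] at h
    split_ifs at h with h1 h2
    · cases h
      subst h2
      simp only [List.count_cons, beq_iff_eq, eq_comm (a := x)]
      omega
    · obtain ⟨v, hv, rfl⟩ := Option.map_eq_some_iff.1 h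
      have := ih v hv
      simp only [List.count_cons]
      omega

theorem count_s_of_ne (i : Fin n) (T : Word n) (x : Fin (n + 1)) (h1 : x ≠ i.castSucc)
    (h2 : x ≠ i.succ) : (s i T).count x = T.count x :=
  s_invariant (F := fun T => T.count x)
    (fun T T' h => by simpa [h1, h2] using f_count i T T' h x) T

theorem count_succ_s (i : Fin n) (T : Word n) :
    (s i T).count i.succ = T.count i.castSucc := by
  have h1 := s_invariant (i := i) (F := fun T : Word n => T.count i.castSucc + T.count i.succ)
    (fun T T' h => by
      have h1 := f_count i T T' h i.castSucc
      have h2 := f_count i T T' h i.succ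
      simp only [if_true, castSucc_ne_succ, (castSucc_ne_succ i).symm, if_false] at h1 h2
      omega) T
  have h2 := wordPhi_add_count i T
  have h3 := wordPhi_add_count i (s i T)
  rw [(s_spec i T).1, (s_spec i T).2.1] at h3
  omega

/-! ### Operators with distant indices -/

/-- The letter map that identifies the two letters moved by `f_k`. -/
def mergeLetter (k : Fin n) (x : Fin (n + 1)) : Fin (n + 1) := if x = k.succ then k.castSucc else x

/-- The word in which the two letters moved by `f_k` are identified. It forgets the action of `f_k`
and keeps that of `f_i` for `|i - k| ≥ 2`. -/
def merge (k : Fin n) (T : Word n) : Word n := T.map (mergeLetter k)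

/-- The indices `i` and `k` are orthogonal nodes of the Dynkin diagram. -/
def Distant (i k : Fin n) : Prop := (i : ℕ) + 1 < k ∨ (k : ℕ) + 1 < i

theorem Distant.symm {i k : Fin n} (h : Distant i k) : Distant k i := Or.symm h

theorem mergeLetter_eq_castSucc {i k : Fin n} (h : Distant i k) (x : Fin (n + 1)) :
    mergeLetter k x = i.castSucc ↔ x = i.castSucc := by
  unfold mergeLetter Distant at *
  split_ifs with hx
  · simp only [Fin.ext_iff, Fin.val_castSucc, Fin.val_succ] at *; omega
  · rfl

theorem mergeLetter_eq_succ {i k : Fin n} (h : Distant i k) (x : Fin (n + 1)) :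
    mergeLetter k x = i.succ ↔ x = i.succ := by
  unfold mergeLetter Distant at *
  split_ifs with hx
  · simp only [Fin.ext_iff, Fin.val_castSucc, Fin.val_succ] at *; omega
  · rfl

theorem wordEps_merge {i k : Fin n} (h : Distant i k) (T : Word n) :
    wordEps i (merge k T) = wordEps i T := by
  induction T with
  | nil => rfl
  | cons x w ih =>
    simp only [merge, List.map_cons, wordEps, letterEps, letterPhi, mergeLetter_eq_castSucc h,
      mergeLetter_eq_succ h] at ih ⊢
    rw [ih]

theorem wordPhi_merge {i k : Fin n} (h : Distant i k) (T : Word n) :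
    wordPhi i (merge k T) = wordPhi i T := by
  induction T with
  | nil => rfl
  | cons x w ih =>
    have hε := wordEps_merge h w
    simp only [merge, List.map_cons, wordPhi, letterPhi, mergeLetter_eq_castSucc h] at ih hε ⊢
    rw [ih, hε]

theorem f_map_merge {i k : Fin n} (h : Distant i k) (T : Word n) :
    (f i T).map (merge k) = f i (merge k T) := by
  induction T with
  | nil => rfl
  | cons x w ih =>
    have hε := wordEps_merge h w
    have hs := (mergeLetter_eq_succ h i.succ).2 rfl
    simp only [merge, List.map_cons, f, letterPhi, mergeLetter_eq_castSucc h] at ih hε ⊢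
    rw [hε, ← ih]
    split_ifs with h1 h2
    all_goals first
      | (simp [merge, hs]; done)
      | (cases f i w <;> simp [merge])

theorem e_map_merge {i k : Fin n} (h : Distant i k) (T : Word n) :
    (e i T).map (merge k) = e i (merge k T) := by
  induction T with
  | nil => rfl
  | cons x w ih =>
    have hε := wordEps_merge h w
    have hs := (mergeLetter_eq_castSucc h i.castSucc).2 rfl
    simp only [merge, List.map_cons, e, letterPhi, mergeLetter_eq_castSucc h,
      mergeLetter_eq_succ h] at ih hε ⊢
    rw [hε, ← ih]
    split_ifs with h1 h2
    all_goals first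
      | (simp [merge, hs]; done)
      | (cases e i w <;> simp [merge])

theorem merge_f (k : Fin n) (T T' : Word n) (h : f k T = some T') : merge k T' = merge k T := by
  induction T generalizing T' with
  | nil => simp [f] at h
  | cons x w ih =>
    simp only [f] at h
    split_ifs at h with h1 h2
    · cases h
      simp [merge, mergeLetter, h2]
    · obtain ⟨v, hv, rfl⟩ := Option.map_eq_some_iff.1 h
      have := ih v hv
      simp only [merge, List.map_cons] at this ⊢
      rw [this]

theorem merge_injective {i k : Fin n} (h : Distant i k) {T T' : Word n}
    (hi : merge i T = merge i T') (hk : merge k T = merge k T') : T = T' := by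
  induction T generalizing T' with
  | nil => cases T' <;> simp_all [merge]
  | cons x w ih =>
    cases T' with
    | nil => simp [merge] at hi
    | cons y v =>
      simp only [merge, List.map_cons, List.cons.injEq] at hi hk
      rw [ih hi.2 hk.2]
      have h1 := hi.1
      have h2 := hk.1
      congr 1
      unfold mergeLetter Distant at *
      split_ifs at h1 h2 <;> simp only [Fin.ext_iff, Fin.val_castSucc, Fin.val_succ] at * <;> omega

theorem merge_s_self (k : Fin n) (T : Word n) : merge k (s k T) = merge k T :=
  s_invariant (merge_f k) T

theorem merge_s {i k : Fin n} (h : Distant i k) (T : Word n) :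
    merge k (s i T) = s i (merge k T) :=
  reversal_map (e_map_merge h) (f_map_merge h) T

theorem s_comm {i k : Fin n} (h : Distant i k) (T : Word n) : s i (s k T) = s k (s i T) := by
  apply merge_injective h
  · rw [merge_s_self, merge_s h.symm, merge_s h.symm, merge_s_self]
  · rw [merge_s_self, merge_s h, merge_s h, merge_s_self]

theorem f_s {i k : Fin n} (h : Distant i k) {T T' : Word n} (hT : f k T = some T') :
    f k (s i T) = some (s i T') := by
  have h1 : (f k (s i T)).map (merge i) = some (merge i T') := by
    rw [f_map_merge h.symm, merge_s_self, ← f_map_merge h.symm, hT]; rfl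
  obtain ⟨V, hV, hV'⟩ := Option.map_eq_some_iff.1 h1
  rw [hV]
  congr 1
  apply merge_injective h
  · rw [hV', merge_s_self]
  · rw [merge_f k _ _ hV, merge_s h, merge_s h, merge_f k _ _ hT]

end Words

/-! ### Three-letter tableaux -/

/-- A semistandard tableau of at most three rows with entries in `{1, 2, 3}`, given by the number
of entries equal to `1, 2, 3` in the first row, to `2, 3` in the second, to `3` in the third. -/
@[ext] structure Tableau where
  a1 : ℕ
  a2 : ℕ
  a3 : ℕ
  b2 : ℕ
  b3 : ℕ
  c3 : ℕ

namespace Tableau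

/-- The columns are strictly increasing. -/
def Valid (t : Tableau) : Prop := t.b2 ≤ t.a1 ∧ t.b2 + t.b3 ≤ t.a1 + t.a2 ∧ t.c3 ≤ t.b2

/-- The lengths of the rows. -/
def shape (t : Tableau) : ℕ × ℕ × ℕ := (t.a1 + t.a2 + t.a3, t.b2 + t.b3, t.c3)

/-- Row insertion of the letter `c ∈ {1, 2, 3}`; for any other `c` nothing is inserted. -/
def insert (c : ℕ) (t : Tableau) : Tableau :=
  if c = 1 then
    if 0 < t.a2 then
      if 0 < t.b3 then ⟨t.a1 + 1, t.a2 - 1, t.a3, t.b2 + 1, t.b3 - 1, t.c3 + 1⟩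
      else ⟨t.a1 + 1, t.a2 - 1, t.a3, t.b2 + 1, t.b3, t.c3⟩
    else if 0 < t.a3 then ⟨t.a1 + 1, t.a2, t.a3 - 1, t.b2, t.b3 + 1, t.c3⟩
    else ⟨t.a1 + 1, t.a2, t.a3, t.b2, t.b3, t.c3⟩
  else if c = 2 then
    if 0 < t.a3 then ⟨t.a1, t.a2 + 1, t.a3 - 1, t.b2, t.b3 + 1, t.c3⟩
    else ⟨t.a1, t.a2 + 1, t.a3, t.b2, t.b3, t.c3⟩
  else if c = 3 then ⟨t.a1, t.a2, t.a3 + 1, t.b2, t.b3, t.c3⟩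
  else t

/-- `ε_1` of a tableau. -/
def eps1 (t : Tableau) : ℕ := t.a2

/-- `φ_1` of a tableau. -/
def phi1 (t : Tableau) : ℕ := t.a1 - t.b2

/-- `ε_2` of a tableau. -/
def eps2 (t : Tableau) : ℕ := t.a3 + (t.b3 - t.a2)

/-- `φ_2` of a tableau. -/
def phi2 (t : Tableau) : ℕ := (t.b2 - t.c3) + (t.a2 - t.b3)

/-- The crystal operator `f_1` on tableaux. It acts on the first row, since the entries `2` of the
second row are all paired with entries `1` of the first. -/
def f1 (t : Tableau) : Option Tableau :=
  if t.b2 < t.a1 then some ⟨t.a1 - 1, t.a2 + 1, t.a3, t.b2, t.b3, t.c3⟩ else none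

/-- The crystal operator `e_1` on tableaux. -/
def e1 (t : Tableau) : Option Tableau :=
  if 0 < t.a2 then some ⟨t.a1 + 1, t.a2 - 1, t.a3, t.b2, t.b3, t.c3⟩ else none

/-- The crystal operator `f_2` on tableaux. It acts on the first row if that has an entry `2` not
paired with a `3` of the second row, and otherwise on the second row. -/
def f2 (t : Tableau) : Option Tableau :=
  if t.b3 < t.a2 then some ⟨t.a1, t.a2 - 1, t.a3 + 1, t.b2, t.b3, t.c3⟩
  else if t.c3 < t.b2 then some ⟨t.a1, t.a2, t.a3, t.b2 - 1, t.b3 + 1, t.c3⟩ else none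

/-- The crystal operator `e_2` on tableaux. -/
def e2 (t : Tableau) : Option Tableau :=
  if t.a2 < t.b3 then some ⟨t.a1, t.a2, t.a3, t.b2 + 1, t.b3 - 1, t.c3⟩
  else if 0 < t.a3 then some ⟨t.a1, t.a2 + 1, t.a3 - 1, t.b2, t.b3, t.c3⟩ else none

theorem Valid.insert {t : Tableau} (h : t.Valid) (c : ℕ) : (insert c t).Valid := by
  unfold Valid Tableau.insert at *
  split_ifs <;> (try dsimp only) <;> omega

/-- Row insertion can be undone when the shapes before and after it are known. -/
theorem insert_injective {t t' : Tableau} (h : t.Valid) (h' : t'.Valid) (hs : t.shape = t'.shape)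
    {c c' : ℕ} (hc : c = 1 ∨ c = 2 ∨ c = 3) (hc' : c' = 1 ∨ c' = 2 ∨ c' = 3)
    (hi : insert c t = insert c' t') : c = c' ∧ t = t' := by
  obtain ⟨a1, a2, a3, b2, b3, c3⟩ := t
  obtain ⟨a1', a2', a3', b2', b3', c3'⟩ := t'
  simp only [Valid, shape, Prod.mk.injEq, Tableau.insert] at *
  rcases hc with rfl | rfl | rfl <;> rcases hc' with rfl | rfl | rfl <;>
    (try simp +decide only [Tableau.mk.injEq, if_true, if_false, true_and, false_and] at *) <;>
    (try split_ifs at hi) <;> (try simp only [Tableau.mk.injEq] at hi) <;> omega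

theorem eps1_insert (t : Tableau) (c : ℕ) :
    eps1 (insert c t) = (if c = 2 then 1 else 0) + (eps1 t - if c = 1 then 1 else 0) := by
  unfold eps1 Tableau.insert
  split_ifs <;> (try dsimp only) <;> omega

theorem eps2_insert (t : Tableau) (c : ℕ) :
    eps2 (insert c t) = (if c = 3 then 1 else 0) + (eps2 t - if c = 2 then 1 else 0) := by
  unfold eps2 Tableau.insert
  split_ifs <;> (try dsimp only) <;> omega

theorem f1_insert {t : Tableau} (h : t.Valid) (c : ℕ) :
    f1 (insert c t) = if eps1 t < (if c = 1 then 1 else 0) then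
      (if c = 1 then some (insert 2 t) else none) else (f1 t).map (insert c) := by
  obtain ⟨a1, a2, a3, b2, b3, c3⟩ := t
  simp only [Valid, eps1, f1] at *
  rcases (by omega : c = 1 ∨ c = 2 ∨ c = 3 ∨ (c ≠ 1 ∧ c ≠ 2 ∧ c ≠ 3)) with
    rfl | rfl | rfl | ⟨h1, h2, h3⟩ <;> simp +decide only [Tableau.insert, *, if_true, if_false] <;>
    split_ifs <;> (try simp +decide only [Option.map_some, Option.map_none, Tableau.insert, *,
      if_true, if_false] at *) <;> grind

theorem e1_insert {t : Tableau} (h : t.Valid) (c : ℕ) :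
    e1 (insert c t) = if eps1 t ≤ (if c = 1 then 1 else 0) then
      (if c = 2 then some (insert 1 t) else none) else (e1 t).map (insert c) := by
  obtain ⟨a1, a2, a3, b2, b3, c3⟩ := t
  simp only [Valid, eps1, e1] at *
  rcases (by omega : c = 1 ∨ c = 2 ∨ c = 3 ∨ (c ≠ 1 ∧ c ≠ 2 ∧ c ≠ 3)) with
    rfl | rfl | rfl | ⟨h1, h2, h3⟩ <;> simp +decide only [Tableau.insert, *, if_true, if_false] <;>
    split_ifs <;> (try simp +decide only [Option.map_some, Option.map_none, Tableau.insert, *,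
      if_true, if_false] at *) <;> grind

theorem f2_insert {t : Tableau} (h : t.Valid) (c : ℕ) :
    f2 (insert c t) = if eps2 t < (if c = 2 then 1 else 0) then
      (if c = 2 then some (insert 3 t) else none) else (f2 t).map (insert c) := by
  obtain ⟨a1, a2, a3, b2, b3, c3⟩ := t
  simp only [Valid, eps2, f2] at *
  rcases (by omega : c = 1 ∨ c = 2 ∨ c = 3 ∨ (c ≠ 1 ∧ c ≠ 2 ∧ c ≠ 3)) with
    rfl | rfl | rfl | ⟨h1, h2, h3⟩ <;> simp +decide only [Tableau.insert, *, if_true, if_false] <;>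
    split_ifs <;> (try simp +decide only [Option.map_some, Option.map_none, Tableau.insert, *,
      if_true, if_false] at *) <;> grind

theorem e2_insert {t : Tableau} (h : t.Valid) (c : ℕ) :
    e2 (insert c t) = if eps2 t ≤ (if c = 2 then 1 else 0) then
      (if c = 3 then some (insert 2 t) else none) else (e2 t).map (insert c) := by
  obtain ⟨a1, a2, a3, b2, b3, c3⟩ := t
  simp only [Valid, eps2, e2] at *
  rcases (by omega : c = 1 ∨ c = 2 ∨ c = 3 ∨ (c ≠ 1 ∧ c ≠ 2 ∧ c ≠ 3)) with
    rfl | rfl | rfl | ⟨h1, h2, h3⟩ <;> simp +decide only [Tableau.insert, *, if_true, if_false] <;>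
    split_ifs <;> (try simp +decide only [Option.map_some, Option.map_none, Tableau.insert, *,
      if_true, if_false] at *) <;> grind

theorem shape_f1 (t t' : Tableau) (h : f1 t = some t') : t'.shape = t.shape := by
  unfold f1 at h
  split_ifs at h; cases h
  simp only [shape, Prod.mk.injEq, and_true]; omega

theorem shape_f2 (t t' : Tableau) (h : f2 t = some t') : t'.shape = t.shape := by
  unfold f2 at h
  split_ifs at h <;> cases h <;> simp only [shape, Prod.mk.injEq, and_true, true_and] <;> omega

theorem stringLength_e1 (t : Tableau) : stringLength e1 t = eps1 t := by
  refine stringLength_eq (p := eps1) (fun t h => ?_) (fun t t' h => ?_) t <;>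
    unfold e1 at h <;> split_ifs at h <;> try cases h
  all_goals simp only [eps1]; omega

theorem stringLength_f1 (t : Tableau) : stringLength f1 t = phi1 t := by
  refine stringLength_eq (p := phi1) (fun t h => ?_) (fun t t' h => ?_) t <;>
    unfold f1 at h <;> split_ifs at h <;> try cases h
  all_goals simp only [phi1]; omega

theorem stringLength_e2 (t : Tableau) : stringLength e2 t = eps2 t := by
  refine stringLength_eq (p := eps2) (fun t h => ?_) (fun t t' h => ?_) t <;>
    unfold e2 at h <;> split_ifs at h <;> try cases h
  all_goals simp only [eps2]; omega

theorem stringLength_f2 (t : Tableau) : stringLength f2 t = phi2 t := by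
  refine stringLength_eq (p := phi2) (fun t h => ?_) (fun t t' h => ?_) t <;>
    unfold f2 at h <;> split_ifs at h <;> try cases h
  all_goals simp only [phi2]; omega

theorem iter_f1 (t : Tableau) (N : ℕ) (hN : N ≤ phi1 t) :
    iter f1 N t = some ⟨t.a1 - N, t.a2 + N, t.a3, t.b2, t.b3, t.c3⟩ := by
  induction N with
  | zero => rfl
  | succ N ih =>
    rw [iter_succ, ih (by omega), Option.bind_some]
    unfold phi1 at hN
    simp only [f1]
    rw [if_pos (by omega)]; rfl

theorem iter_e1 (t : Tableau) (N : ℕ) (hN : N ≤ eps1 t) :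
    iter e1 N t = some ⟨t.a1 + N, t.a2 - N, t.a3, t.b2, t.b3, t.c3⟩ := by
  induction N with
  | zero => rfl
  | succ N ih =>
    rw [iter_succ, ih (by omega), Option.bind_some]
    unfold eps1 at hN
    simp only [e1]
    rw [if_pos (by omega)]; rfl

theorem iter_f2 (t : Tableau) (N : ℕ) (hN : N ≤ phi2 t) :
    iter f2 N t = some ⟨t.a1, t.a2 - min N (t.a2 - t.b3), t.a3 + min N (t.a2 - t.b3),
      t.b2 - (N - (t.a2 - t.b3)), t.b3 + (N - (t.a2 - t.b3)), t.c3⟩ := by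
  induction N with
  | zero => simp [iter_zero]
  | succ N ih =>
    rw [iter_succ, ih (by omega), Option.bind_some]
    unfold phi2 at hN
    simp only [f2]
    split_ifs <;> (try simp only [Option.some.injEq, Tableau.mk.injEq, and_true, true_and]) <;> omega

theorem iter_e2 (t : Tableau) (N : ℕ) (hN : N ≤ eps2 t) :
    iter e2 N t = some ⟨t.a1, t.a2 + (N - (t.b3 - t.a2)), t.a3 - (N - (t.b3 - t.a2)),
      t.b2 + min N (t.b3 - t.a2), t.b3 - min N (t.b3 - t.a2), t.c3⟩ := by
  induction N with
  | zero => simp [iter_zero]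
  | succ N ih =>
    rw [iter_succ, ih (by omega), Option.bind_some]
    unfold eps2 at hN
    simp only [e2]
    split_ifs <;> (try simp only [Option.some.injEq, Tableau.mk.injEq, and_true, true_and]) <;> omega

/-- The simple reflection `s_1` on tableaux. -/
def s1 (t : Tableau) : Tableau := ⟨t.b2 + t.a2, t.a1 - t.b2, t.a3, t.b2, t.b3, t.c3⟩

/-- The simple reflection `s_2` on tableaux. The `min a₂ b₃` pairs between the first two rows and the
`c₃` pairs between the last two stay; the free entries are redistributed. -/
def s2 (t : Tableau) : Tableau :=
  ⟨t.a1, min t.a2 t.b3 + (t.a3 - (t.b2 - t.c3)), (t.a2 - t.b3) + min t.a3 (t.b2 - t.c3),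
    t.b2 + (t.b3 - t.a2) - (t.b2 - t.c3 - t.a3), min t.a2 t.b3 + (t.b2 - t.c3 - t.a3), t.c3⟩

theorem reversal_one {t : Tableau} (h : t.Valid) : reversal e1 f1 t = s1 t := by
  unfold reversal
  rw [stringLength_e1, stringLength_f1, iter_f1 _ _ (by omega), iter_e1 _ _ (by omega)]
  unfold Valid eps1 phi1 s1 at *
  split_ifs <;> simp only [Option.getD_some, Tableau.mk.injEq, and_true] <;> omega

theorem reversal_two {t : Tableau} (h : t.Valid) : reversal e2 f2 t = s2 t := by
  unfold reversal
  rw [stringLength_e2, stringLength_f2, iter_f2 _ _ (by omega), iter_e2 _ _ (by omega)]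
  unfold Valid eps2 phi2 s2 at *
  split_ifs <;> simp only [Option.getD_some, Tableau.mk.injEq, and_true, true_and] <;> omega

theorem braid {t : Tableau} (h : t.Valid) : s1 (s2 (s1 t)) = s2 (s1 (s2 t)) := by
  obtain ⟨a1, a2, a3, b2, b3, c3⟩ := t
  simp only [Valid, Tableau.s1, Tableau.s2, Tableau.mk.injEq, and_true] at h ⊢
  refine ⟨?_, ?_, ?_, ?_, ?_⟩ <;> omega

/-- Along `f_2`, the lengths of the `1`-string of `t` and of the `2`-string of `s_1 t` change by
opposite amounts. -/
theorem string_lengths_f2 {t t' : Tableau} (h : t.Valid) (hf : f2 t = some t') :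
    eps1 t' + phi1 t' + (eps2 (s1 t') + phi2 (s1 t')) =
      eps1 t + phi1 t + (eps2 (s1 t) + phi2 (s1 t)) := by
  unfold f2 at hf
  unfold Valid at h
  split_ifs at hf <;> cases hf <;> simp only [eps1, phi1, eps2, phi2, s1] <;> omega

end Tableau

/-! ### Row insertion of words -/

section Insertion

variable {n : ℕ}

/-- The place of a letter among the letters `1, 2, 3` moved by `f_i` and `f_j`, where `j = i + 1`;
the value is `0` for the other letters. -/
def letterClass (i j : Fin n) (x : Fin (n + 1)) : ℕ :=
  if x = i.castSucc then 1 else if x = i.succ then 2 else if x = j.succ then 3 else 0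

/-- The insertion tableau of the letters moved by `f_i` and `f_j`. The letters are inserted from right
to left, as the tensor product rule in use reads tableaux from top to bottom and each row from right
to left. -/
def tableau (i j : Fin n) : Word n → Tableau
  | [] => ⟨0, 0, 0, 0, 0, 0⟩
  | x :: w => (tableau i j w).insert (letterClass i j x)

/-- The recording data of the insertion: the shapes of the successive tableaux, and the letters that
are not inserted. -/
def recording (i j : Fin n) : Word n → List ((ℕ × ℕ × ℕ) × Option (Fin (n + 1)))
  | [] => []
  | x :: w => ((tableau i j (x :: w)).shape, if letterClass i j x = 0 then some x else none) ::
      recording i j w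

theorem tableau_valid (i j : Fin n) (T : Word n) : (tableau i j T).Valid := by
  induction T with
  | nil => simp [tableau, Tableau.Valid]
  | cons x w ih => exact ih.insert _

theorem letterClass_injective {i j : Fin n} {x y : Fin (n + 1)}
    (h : letterClass i j x = letterClass i j y) (h0 : letterClass i j x ≠ 0) : x = y := by
  unfold letterClass at *
  split_ifs at * <;> simp_all

theorem letterClass_le (i j : Fin n) (x : Fin (n + 1)) : letterClass i j x ≤ 3 := by
  unfold letterClass
  split_ifs <;> omega

/-- A word is determined by its insertion tableau and its recording data. -/
theorem tableau_recording_injective {i j : Fin n} {T T' : Word n}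
    (h1 : tableau i j T = tableau i j T') (h2 : recording i j T = recording i j T') : T = T' := by
  induction T generalizing T' with
  | nil => cases T' <;> simp_all [recording]
  | cons x w ih =>
    cases T' with
    | nil => simp [recording] at h2
    | cons y v =>
      simp only [recording, List.cons.injEq, Prod.mk.injEq] at h2
      obtain ⟨⟨-, h3⟩, h4⟩ := h2
      simp only [tableau] at h1
      have hshape : (tableau i j w).shape = (tableau i j v).shape := by
        cases w <;> cases v <;> simp_all [recording]
      have hx := letterClass_le i j x
      have hy := letterClass_le i j y
      by_cases h0 : letterClass i j x = 0
      · by_cases h0' : letterClass i j y = 0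
        · simp only [h0, h0', if_true, Option.some.injEq] at h3
          subst h3
          rw [h0] at h1
          rw [ih (by simpa [Tableau.insert] using h1) h4]
        · simp [h0, h0'] at h3
      · by_cases h0' : letterClass i j y = 0
        · simp [h0, h0'] at h3
        · obtain ⟨h5, h6⟩ := Tableau.insert_injective (tableau_valid i j w) (tableau_valid i j v)
            hshape (by omega) (by omega) h1
          rw [letterClass_injective h5 h0, ih h6 h4]

theorem castSucc_eq_succ {i j : Fin n} (h : (i : ℕ) + 1 = j) : j.castSucc = i.succ := by
  simp [Fin.ext_iff, h]

theorem letterClass_eq_one (i j : Fin n) (x : Fin (n + 1)) :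
    letterClass i j x = 1 ↔ x = i.castSucc := by
  unfold letterClass
  split_ifs <;> simp_all

theorem letterClass_eq_two {i j : Fin n} (h : (i : ℕ) + 1 = j) (x : Fin (n + 1)) :
    letterClass i j x = 2 ↔ x = i.succ := by
  have := castSucc_ne_succ i
  unfold letterClass
  split_ifs <;> simp_all [Fin.ext_iff]

theorem letterClass_eq_three {i j : Fin n} (h : (i : ℕ) + 1 = j) (x : Fin (n + 1)) :
    letterClass i j x = 3 ↔ x = j.succ := by
  unfold letterClass
  split_ifs <;> simp_all [Fin.ext_iff]; omega

theorem wordEps_left {i j : Fin n} (h : (i : ℕ) + 1 = j) (T : Word n) :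
    wordEps i T = (tableau i j T).eps1 := by
  induction T with
  | nil => rfl
  | cons x w ih =>
    simp only [tableau, wordEps, Tableau.eps1_insert, letterEps, letterPhi, ih,
      letterClass_eq_one i j, letterClass_eq_two h]

theorem wordEps_right {i j : Fin n} (h : (i : ℕ) + 1 = j) (T : Word n) :
    wordEps j T = (tableau i j T).eps2 := by
  induction T with
  | nil => rfl
  | cons x w ih =>
    simp only [tableau, wordEps, Tableau.eps2_insert, letterEps, letterPhi, ih,
      letterClass_eq_two h, letterClass_eq_three h, castSucc_eq_succ h]

theorem f_left {i j : Fin n} (h : (i : ℕ) + 1 = j) (T : Word n) :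
    (f i T).map (tableau i j) = (tableau i j T).f1 := by
  induction T with
  | nil => rfl
  | cons x w ih =>
    simp only [tableau, Tableau.f1_insert (tableau_valid i j w), f, ← wordEps_left h, letterPhi,
      letterClass_eq_one i j, ← ih]
    have := (letterClass_eq_two h i.succ).2 rfl
    split_ifs <;> simp [tableau, this, Function.comp_def]

theorem e_left {i j : Fin n} (h : (i : ℕ) + 1 = j) (T : Word n) :
    (e i T).map (tableau i j) = (tableau i j T).e1 := by
  induction T with
  | nil => rfl
  | cons x w ih =>
    simp only [tableau, Tableau.e1_insert (tableau_valid i j w), e, ← wordEps_left h, letterPhi,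
      letterClass_eq_one i j, letterClass_eq_two h, ← ih]
    have := (letterClass_eq_one i j i.castSucc).2 rfl
    split_ifs <;> simp [tableau, this, Function.comp_def]

theorem f_right {i j : Fin n} (h : (i : ℕ) + 1 = j) (T : Word n) :
    (f j T).map (tableau i j) = (tableau i j T).f2 := by
  induction T with
  | nil => rfl
  | cons x w ih =>
    simp only [tableau, Tableau.f2_insert (tableau_valid i j w), f, ← wordEps_right h, letterPhi,
      letterClass_eq_two h, ← ih, castSucc_eq_succ h]
    have := (letterClass_eq_three h j.succ).2 rfl
    split_ifs <;> simp [tableau, this, Function.comp_def]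

theorem e_right {i j : Fin n} (h : (i : ℕ) + 1 = j) (T : Word n) :
    (e j T).map (tableau i j) = (tableau i j T).e2 := by
  induction T with
  | nil => rfl
  | cons x w ih =>
    simp only [tableau, Tableau.e2_insert (tableau_valid i j w), e, ← wordEps_right h, letterPhi,
      letterClass_eq_two h, letterClass_eq_three h, ← ih, castSucc_eq_succ h]
    have := (letterClass_eq_two h i.succ).2 rfl
    split_ifs <;> simp [tableau, this, Function.comp_def]

theorem recording_f_left {i j : Fin n} (h : (i : ℕ) + 1 = j) (T T' : Word n)
    (hT : f i T = some T') :
    recording i j T' = recording i j T := by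
  induction T generalizing T' with
  | nil => simp [f] at hT
  | cons x w ih =>
    have hs : (tableau i j T').shape = (tableau i j (x :: w)).shape :=
      Tableau.shape_f1 _ _ (by rw [← f_left h, hT]; rfl)
    simp only [f] at hT
    split_ifs at hT with h1 h2
    · cases hT
      have e1 := (letterClass_eq_two h i.succ).2 rfl
      have e2 := (letterClass_eq_one i j x).2 h2
      simp only [recording, hs, e1, e2]
      simp
    · obtain ⟨v, hv, rfl⟩ := Option.map_eq_some_iff.1 hT
      simp only [recording, hs, ih v hv]

theorem recording_f_right {i j : Fin n} (h : (i : ℕ) + 1 = j) (T T' : Word n)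
    (hT : f j T = some T') :
    recording i j T' = recording i j T := by
  induction T generalizing T' with
  | nil => simp [f] at hT
  | cons x w ih =>
    have hs : (tableau i j T').shape = (tableau i j (x :: w)).shape :=
      Tableau.shape_f2 _ _ (by rw [← f_right h, hT]; rfl)
    simp only [f] at hT
    split_ifs at hT with h1 h2
    · cases hT
      have e1 := (letterClass_eq_three h j.succ).2 rfl
      have e2 := (letterClass_eq_two h x).2 (h2.trans (castSucc_eq_succ h))
      simp only [recording, hs, e1, e2]
      simp
    · obtain ⟨v, hv, rfl⟩ := Option.map_eq_some_iff.1 hT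
      simp only [recording, hs, ih v hv]

theorem tableau_s_left {i j : Fin n} (h : (i : ℕ) + 1 = j) (T : Word n) :
    tableau i j (s i T) = (tableau i j T).s1 := by
  rw [s_eq_reversal, reversal_map (e_left h) (f_left h), Tableau.reversal_one (tableau_valid i j T)]

theorem tableau_s_right {i j : Fin n} (h : (i : ℕ) + 1 = j) (T : Word n) :
    tableau i j (s j T) = (tableau i j T).s2 := by
  rw [s_eq_reversal, reversal_map (e_right h) (f_right h),
    Tableau.reversal_two (tableau_valid i j T)]

theorem recording_s_left {i j : Fin n} (h : (i : ℕ) + 1 = j) (T : Word n) :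
    recording i j (s i T) = recording i j T :=
  s_invariant (recording_f_left h) T

theorem recording_s_right {i j : Fin n} (h : (i : ℕ) + 1 = j) (T : Word n) :
    recording i j (s j T) = recording i j T :=
  s_invariant (recording_f_right h) T

/-- The braid relation, transported from tableaux along the injective map given by insertion. -/
theorem s_braid {i j : Fin n} (h : (i : ℕ) + 1 = j) (T : Word n) :
    s i (s j (s i T)) = s j (s i (s j T)) := by
  apply tableau_recording_injective (i := i) (j := j)
  · simp only [tableau_s_left h, tableau_s_right h, Tableau.braid (tableau_valid i j T)]
  · simp only [recording_s_left h, recording_s_right h]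

theorem wordPhi_left {i j : Fin n} (h : (i : ℕ) + 1 = j) (T : Word n) :
    wordPhi i T = (tableau i j T).phi1 := by
  rw [← stringLength_f, stringLength_map (f_left h), Tableau.stringLength_f1]

theorem wordPhi_right {i j : Fin n} (h : (i : ℕ) + 1 = j) (T : Word n) :
    wordPhi j T = (tableau i j T).phi2 := by
  rw [← stringLength_f, stringLength_map (f_right h), Tableau.stringLength_f2]

/-- The length of the `k`-string through `T`. -/
def ell (k : Fin n) (T : Word n) : ℕ := wordEps k T + wordPhi k T

/-- The identity in type `A_2` on which the invariance of the atomic number rests. -/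
theorem ell_add_ell_f {i j : Fin n} (h : (i : ℕ) + 1 = j) {T T' : Word n} (hT : f j T = some T') :
    ell i T' + ell j (s i T') = ell i T + ell j (s i T) := by
  have h1 : (tableau i j T).f2 = some (tableau i j T') := by rw [← f_right h, hT]; rfl
  simp only [ell, wordEps_left h, wordPhi_left h, wordEps_right h, wordPhi_right h,
    tableau_s_left h]
  exact Tableau.string_lengths_f2 (tableau_valid i j T) h1

end Insertion

/-! ### The elements `s_{k-1} ⋯ s_j (T)` -/

section Chains

variable {n : ℕ}

theorem mem_chain {j k m : Fin n} : m ∈ chain j k ↔ j ≤ m ∧ m < k := by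
  simp [chain]

theorem chain_sortedLT (j k : Fin n) : (chain j k).Pairwise (· < ·) :=
  (List.sortedLT_finRange n).pairwise.filter _

theorem chain_append {j m k : Fin n} (h1 : j ≤ m) (h2 : m ≤ k) :
    chain j k = chain j m ++ chain m k := by
  refine (chain_sortedLT j k).eq_of_mem_iff (List.pairwise_append.2
    ⟨chain_sortedLT j m, chain_sortedLT m k, fun a ha b hb => ?_⟩) fun a => ?_
  · exact (mem_chain.1 ha).2.trans_le (mem_chain.1 hb).1
  · simp only [List.mem_append, mem_chain]
    omega

theorem chain_succ {j k : Fin n} (h : (j : ℕ) + 1 = k) : chain j k = [j] := by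
  refine (chain_sortedLT j k).eq_of_mem_iff (List.pairwise_singleton _ _) fun a => ?_
  simp only [mem_chain, List.mem_singleton]
  omega

/-- The element `w⁻¹ T = s_{k-1} ⋯ s_j (T)` for `w = s_j ⋯ s_{k-1}`. -/
noncomputable def pull (j k : Fin n) (T : Word n) : Word n := weyl (chain j k).reverse T

theorem pull_self (k : Fin n) (T : Word n) : pull k k T = T := by
  have : chain k k = [] := List.eq_nil_iff_forall_not_mem.2 fun m hm => by
    have := mem_chain.1 hm
    omega
  simp [pull, this, weyl]

theorem pull_pull {j m k : Fin n} (h1 : j ≤ m) (h2 : m ≤ k) (T : Word n) :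
    pull m k (pull j m T) = pull j k T := by
  rw [pull, pull, pull, chain_append h1 h2, List.reverse_append, weyl, weyl, weyl,
    List.foldr_append]

theorem pull_succ {j k : Fin n} (h : (j : ℕ) + 1 = k) (T : Word n) : pull j k T = s j T := by
  rw [pull, chain_succ h]; rfl

theorem pull_s_of_distant {i j k : Fin n} (h : ∀ m, j ≤ m → m < k → Distant m i) (T : Word n) :
    pull j k (s i T) = s i (pull j k T) := by
  have : ∀ l : List (Fin n), (∀ m ∈ l, Distant m i) → weyl l (s i T) = s i (weyl l T) := by
    intro l hl
    induction l with
    | nil => rfl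
    | cons a l ih =>
      change s a (weyl l (s i T)) = s i (s a (weyl l T))
      rw [ih fun m hm => hl m (List.mem_cons_of_mem _ hm), s_comm (hl a List.mem_cons_self)]
  exact this _ fun m hm => h m (mem_chain.1 (List.mem_reverse.1 hm)).1
    (mem_chain.1 (List.mem_reverse.1 hm)).2

theorem f_pull_of_distant {i j k : Fin n} (h : ∀ m, j ≤ m → m < k → Distant m i) {T T' : Word n}
    (hT : f i T = some T') : f i (pull j k T) = some (pull j k T') := by
  have : ∀ l : List (Fin n), (∀ m ∈ l, Distant m i) → f i (weyl l T) = some (weyl l T') := by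
    intro l hl
    induction l with
    | nil => exact hT
    | cons a l ih =>
      exact f_s (hl a List.mem_cons_self) (ih fun m hm => hl m (List.mem_cons_of_mem _ hm))
  exact this _ fun m hm => h m (mem_chain.1 (List.mem_reverse.1 hm)).1
    (mem_chain.1 (List.mem_reverse.1 hm)).2

/-! ### The atomic number as a sum of string lengths -/

theorem ell_f {k : Fin n} {T T' : Word n} (hT : f k T = some T') : ell k T' = ell k T := by
  have := f_spec k T T' hT
  unfold ell
  omega

theorem ell_f_of_distant {i k : Fin n} (h : Distant k i) {T T' : Word n} (hT : f i T = some T') :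
    ell k T' = ell k T := by
  rw [ell, ell, ← wordEps_merge h, ← wordPhi_merge h, merge_f i T T' hT, wordEps_merge h,
    wordPhi_merge h]

theorem ell_s_of_distant {i k : Fin n} (h : Distant k i) (T : Word n) :
    ell k (s i T) = ell k T :=
  s_invariant (fun _ _ => ell_f_of_distant h) T

theorem weyl_reverse_weyl (l : List (Fin n)) (T : Word n) : weyl l.reverse (weyl l T) = T := by
  induction l with
  | nil => rfl
  | cons a l ih =>
    rw [List.reverse_cons, weyl, List.foldr_append]
    change weyl l.reverse (s a (s a (weyl l T))) = T
    rw [s_s, ih]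

theorem epsRoot_eq (j k : Fin n) (T : Word n) : epsRoot j k T = wordEps k (pull j k T) := by
  rw [← stringLength_e, epsRoot]
  refine stringLength_map (fun T => ?_) T
  rw [eRoot, conj, Option.map_map]
  have : pull j k ∘ weyl (chain j k) = id := funext fun T => weyl_reverse_weyl _ T
  rw [this, Option.map_id]; rfl

/-- Since `w(α_k) = α_{j,k}` for `w = s_j ⋯ s_{k-1}`, the letters counted by the weight of `w⁻¹ T` at
`k` are those counted by the weight of `T` at the coroot of `α_{j,k}`. -/
theorem count_pull {j k : Fin n} (h : j ≤ k) (T : Word n) :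
    (pull j k T).count k.castSucc = T.count j.castSucc ∧
      ∀ x : Fin (n + 1), (k : ℕ) < x → (pull j k T).count x = T.count x := by
  obtain ⟨d, hd⟩ : ∃ d : ℕ, (k : ℕ) = j + d := ⟨k - j, by omega⟩
  induction d generalizing k with
  | zero =>
    obtain rfl : k = j := Fin.ext hd
    simp [pull_self]
  | succ d ih =>
    let m : Fin n := ⟨j + d, by omega⟩
    have hm : (m : ℕ) + 1 = k := by simp [m, hd]; omega
    have hjm : j ≤ m := by simp [m, Fin.le_def]
    obtain ⟨h1, h2⟩ := ih hjm rfl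
    rw [← pull_pull hjm (by omega : m ≤ k), pull_succ hm]
    refine ⟨?_, fun x hx => ?_⟩
    · rw [castSucc_eq_succ hm, count_succ_s, h1]
    · rw [count_s_of_ne, h2 x (by omega)] <;> simp [Fin.ext_iff] <;> omega

theorem corootPairing_wt {j k : Fin n} (h : j ≤ k) (T : Word n) :
    corootPairing (wt T) j k = (T.count j.castSucc : ℤ) - T.count k.succ := by
  obtain ⟨d, hd⟩ : ∃ d : ℕ, (k : ℕ) = j + d := ⟨k - j, by omega⟩
  induction d generalizing k with
  | zero =>
    obtain rfl : k = j := Fin.ext hd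
    simp [corootPairing, wt]
  | succ d ih =>
    let m : Fin n := ⟨j + d, by omega⟩
    have hm : (m : ℕ) + 1 = k := by simp [m, hd]; omega
    have hjm : j ≤ m := by simp [m, Fin.le_def]
    have hI : Finset.Icc j k = insert k (Finset.Icc j m) := by
      ext a
      simp only [Finset.mem_Icc, Finset.mem_insert]
      omega
    have := ih hjm rfl
    rw [corootPairing] at this ⊢
    rw [hI, Finset.sum_insert (by simp; omega), this, wt, castSucc_eq_succ hm]
    ring

/-- The pairing with a coroot is `φ_α - ε_α`, so that adding `2 ε_α` gives the length `φ_α + ε_α` of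
the `α`-string. -/
theorem corootPairing_add_epsRoot {j k : Fin n} (h : j ≤ k) (T : Word n) :
    corootPairing (wt T) j k + 2 * (epsRoot j k T : ℤ) = ell k (pull j k T) := by
  obtain ⟨h1, h2⟩ := count_pull h T
  have h3 := wordPhi_add_count k (pull j k T)
  rw [h1, h2 k.succ (by simp)] at h3
  rw [corootPairing_wt h, epsRoot_eq, ell]
  omega

/-- The sum over `j ≤ k` of the lengths of the `α_{j,k}`-strings through `T`. -/
noncomputable def stringSum (k : Fin n) (T : Word n) : ℕ := ∑ j ∈ Finset.Iic k, ell k (pull j k T)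

theorem atomicNumber_eq (T : Word n) : atomicNumber T = (1 / 2 : ℚ) * ∑ k, (stringSum k T : ℚ) := by
  have h : ∀ p ∈ posRoots n, (corootPairing (wt T) p.1 p.2 : ℚ) + 2 * (epsRoot p.1 p.2 T : ℚ) =
      (ell p.2 (pull p.1 p.2 T) : ℚ) := fun p hp => by
    have := corootPairing_add_epsRoot (Finset.mem_filter.1 hp).2 T
    exact_mod_cast this
  have h2 : ∑ p ∈ posRoots n, (ell p.2 (pull p.1 p.2 T) : ℚ) = ∑ k, (stringSum k T : ℚ) := by
    simp only [stringSum, Nat.cast_sum, posRoots]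
    rw [Finset.sum_filter, ← Finset.univ_product_univ, Finset.sum_product_right]
    refine Finset.sum_congr rfl fun k _ => ?_
    rw [← Finset.sum_filter]
    refine Finset.sum_congr ?_ fun _ _ => rfl
    ext j
    simp
  rw [← h2, ← Finset.sum_congr rfl h, Finset.sum_add_distrib, ← Finset.mul_sum, atomicNumber,
    rhoPairing]
  ring

/-! ### Invariance -/

/-- For `j < i < k` the reflection `s_i` fixes `α_{j,k}`. With `w = s_j ⋯ s_{k-1}`, the braid relation
gives `w⁻¹ s_i = s_{i-1} w⁻¹`, and `s_{i-1}` commutes with `e_k` and `f_k`. -/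
theorem ell_pull_s_of_lt {i j k : Fin n} (hji : j < i) (hik : i < k) (T : Word n) :
    ell k (pull j k (s i T)) = ell k (pull j k T) := by
  let a : Fin n := ⟨i - 1, by omega⟩
  let b : Fin n := ⟨i + 1, by omega⟩
  have ha : (a : ℕ) + 1 = i := by simp only [a]; omega
  have hb : (i : ℕ) + 1 = b := rfl
  have hdec : ∀ U, pull j k U = pull b k (s i (s a (pull j a U))) := fun U => by
    rw [← pull_succ ha, ← pull_succ hb, pull_pull, pull_pull, pull_pull] <;> omega
  have hj : ∀ m, j ≤ m → m < a → Distant m i := fun m _ hm => Or.inl (by omega)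
  have hk : ∀ m, b ≤ m → m < k → Distant m a := fun m hm _ => Or.inr (by omega)
  rw [hdec, hdec, pull_s_of_distant hj, ← s_braid ha, pull_s_of_distant hk,
    ell_s_of_distant (Or.inr (by omega))]

/-- The terms of `stringSum k` are permuted by `s_i` for `i < k`. -/
theorem ell_pull_s {i k : Fin n} (hik : i < k) {i' : Fin n} (hi' : (i : ℕ) + 1 = i') {j : Fin n}
    (hjk : j ≤ k) (T : Word n) : ell k (pull j k (s i T)) = ell k (pull (Equiv.swap i i' j) k T) := by
  have hii : i ≠ i' := fun h => by omega
  rcases lt_trichotomy j i with h | h | h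
  · rw [Equiv.swap_apply_of_ne_of_ne h.ne (fun h' => by omega), ell_pull_s_of_lt h hik]
  · subst h
    rw [Equiv.swap_apply_left, ← pull_pull (m := i') (by omega) (by omega), pull_succ hi', s_s]
  · by_cases h' : j = i'
    · subst h'
      rw [Equiv.swap_apply_right, ← pull_pull (j := i) (m := j) (by omega) (by omega),
        pull_succ hi']
    · rw [Equiv.swap_apply_of_ne_of_ne h.ne' h']
      rw [pull_s_of_distant fun m hm _ => Or.inr (by omega), ell_s_of_distant (Or.inr (by omega))]

theorem stringSum_s {i k : Fin n} (hik : i < k) (T : Word n) :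
    stringSum k (s i T) = stringSum k T := by
  let i' : Fin n := ⟨i + 1, by omega⟩
  have hi' : (i : ℕ) + 1 = i' := rfl
  have hmem : ∀ j ∈ Finset.Iic k, Equiv.swap i i' j ∈ Finset.Iic k := fun j hj => by
    rw [Finset.mem_Iic] at hj ⊢
    rw [Equiv.swap_apply_def]
    split_ifs <;> omega
  refine Finset.sum_nbij' (Equiv.swap i i') (Equiv.swap i i') hmem hmem (by simp) (by simp) ?_
  exact fun j hj => ell_pull_s hik hi' (Finset.mem_Iic.1 hj) T

theorem stringSum_f_of_lt {i k : Fin n} (h : (k : ℕ) + 1 < i) {T T' : Word n}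
    (hT : f i T = some T') : stringSum k T' = stringSum k T :=
  Finset.sum_congr rfl fun j _ => ell_f_of_distant (Or.inl h)
    (f_pull_of_distant (fun m _ hm => Or.inl (by omega)) hT)

/-- Along `f_i`, the string lengths for the roots `α_{j,i-1}` and `α_{j,i}` with `j < i` change by
opposite amounts, and that for `α_{i,i}` does not change. -/
theorem stringSum_add_stringSum_f {i k : Fin n} (h : (k : ℕ) + 1 = i) {T T' : Word n}
    (hT : f i T = some T') : stringSum k T' + stringSum i T' = stringSum k T + stringSum i T := by
  have hI : Finset.Iic i = insert i (Finset.Iic k) := by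
    ext a
    simp only [Finset.mem_Iic, Finset.mem_insert]
    omega
  have hi : i ∉ Finset.Iic k := by simp; omega
  simp only [stringSum]
  rw [hI, Finset.sum_insert hi, Finset.sum_insert hi, pull_self, pull_self, ell_f hT,
    add_left_comm, ← Finset.sum_add_distrib, add_left_comm (∑ j ∈ Finset.Iic k, ell k (pull j k T)),
    ← Finset.sum_add_distrib]
  congr 1
  refine Finset.sum_congr rfl fun j hj => ?_
  have hjk := Finset.mem_Iic.1 hj
  rw [← pull_pull hjk (by omega : k ≤ i), ← pull_pull hjk (by omega : k ≤ i), pull_succ h,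
    pull_succ h]
  exact ell_add_ell_f h (f_pull_of_distant (fun m _ hm => Or.inl (by omega)) hT)

/-- The contribution to the atomic number of the roots spanned by `α_1, …, α_i` is constant
along `f_i`. -/
theorem sum_Iic_stringSum_f {i : Fin n} {T T' : Word n} (hT : f i T = some T') :
    ∑ k ∈ Finset.Iic i, stringSum k T' = ∑ k ∈ Finset.Iic i, stringSum k T := by
  by_cases h0 : (i : ℕ) = 0
  · have hI : Finset.Iic i = {i} := by
      ext a
      simp only [Finset.mem_Iic, Finset.mem_singleton]
      omega
    simp only [hI, Finset.sum_singleton, stringSum, pull_self, ell_f hT]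
  · let a : Fin n := ⟨i - 1, by omega⟩
    have ha : (a : ℕ) + 1 = i := by simp only [a]; omega
    have hI : Finset.Iic i = insert i (insert a (Finset.Iio a)) := by
      ext b
      simp only [Finset.mem_Iic, Finset.mem_insert, Finset.mem_Iio]
      omega
    have hi : i ∉ insert a (Finset.Iio a) := by simp; omega
    rw [hI, Finset.sum_insert hi, Finset.sum_insert hi, Finset.sum_insert (by simp),
      Finset.sum_insert (by simp), Finset.sum_congr rfl fun k hk =>
        stringSum_f_of_lt (by have := Finset.mem_Iio.1 hk; omega) hT]
    have := stringSum_add_stringSum_f ha hT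
    omega

theorem atomicNumber_s (i : Fin n) (T : Word n) : atomicNumber (s i T) = atomicNumber T := by
  rw [atomicNumber_eq, atomicNumber_eq]
  congr 1
  have hsplit : ∀ U : Word n, ∑ k, (stringSum k U : ℚ) =
      ((∑ k ∈ Finset.Iic i, stringSum k U : ℕ) : ℚ) + ∑ k ∈ Finset.Ioi i, (stringSum k U : ℚ) := by
    intro U
    rw [Nat.cast_sum, ← Finset.sum_union (Finset.disjoint_left.2 fun a => by simp)]
    refine Finset.sum_congr ?_ fun _ _ => rfl
    ext a
    simp [le_or_gt]
  rw [hsplit, hsplit, s_invariant (i := i) (F := fun U => ∑ k ∈ Finset.Iic i, stringSum k U)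
    fun _ _ => sum_Iic_stringSum_f]
  congr 1
  exact Finset.sum_congr rfl fun k hk => by rw [stringSum_s (Finset.mem_Ioi.1 hk)]

theorem atomicNumber_weyl (l : List (Fin n)) (T : Word n) :
    atomicNumber (weyl l T) = atomicNumber T := by
  induction l with
  | nil => rfl
  | cons a l ih => exact (atomicNumber_s a _).trans ih

theorem atomicNumber_f_last {m : Fin n} (hm : (m : ℕ) + 1 = n) {T T' : Word n}
    (hT : f m T = some T') : atomicNumber T' = atomicNumber T := by
  have hI : (Finset.univ : Finset (Fin n)) = Finset.Iic m := by
    ext a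
    simp only [Finset.mem_univ, Finset.mem_Iic, true_iff]
    omega
  have := sum_Iic_stringSum_f hT
  rw [atomicNumber_eq, atomicNumber_eq, hI]
  exact_mod_cast congrArg (fun N : ℕ => (1 / 2 : ℚ) * N) this

theorem atomicNumber_eq_of_eqvGen {r : Word n → Word n → Prop}
    (h : ∀ T T', r T T' → atomicNumber T = atomicNumber T') {T T' : Word n}
    (hT : Relation.EqvGen r T T') : atomicNumber T = atomicNumber T' := by
  induction hT with
  | rel _ _ hr => exact h _ _ hr
  | refl => rfl
  | symm _ _ _ ih => exact ih.symm
  | trans _ _ _ _ _ ih1 ih2 => exact ih1.trans ih2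

theorem atomicNumber_eq_of_sameOrbit {T T' : Word n} (h : SameOrbit T T') :
    atomicNumber T = atomicNumber T' := by
  obtain ⟨l, rfl⟩ := h
  exact atomicNumber_weyl l T'

theorem atomicNumber_eq_of_isTildeF {j k : Fin n} {T T' : Word n} (h : IsTildeF j k T' T) :
    atomicNumber T = atomicNumber T' := by
  obtain ⟨l, m, hm, -, hT⟩ := h
  obtain ⟨V, hV, rfl⟩ := Option.map_eq_some_iff.1 hT
  rw [atomicNumber_weyl, atomicNumber_f_last hm hV, atomicNumber_weyl]

theorem atomicNumber_eq_of_LLEquiv {lam : Weight n} {T T' : Word n} (h : LLEquiv lam T T') :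
    atomicNumber T = atomicNumber T' := by
  obtain ⟨D, D', ⟨h1, -⟩, ⟨h2, -⟩, h3⟩ := h
  rw [← atomicNumber_eq_of_sameOrbit h1, ← atomicNumber_eq_of_sameOrbit h2]
  exact atomicNumber_eq_of_eqvGen (fun _ _ ⟨_, _, _, _, hp⟩ => atomicNumber_eq_of_isTildeF hp) h3

theorem atomicNumber_eq_of_orbitEdge {lam : Weight n} {T T' : Word n} (h : OrbitEdge lam T T') :
    atomicNumber T = atomicNumber T' := by
  obtain ⟨-, -, h | ⟨m, hm, hT⟩⟩ := h
  · exact atomicNumber_eq_of_sameOrbit h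
  · exact atomicNumber_f_last hm hT

end Chains

end TypeACrystal

theorem proposition1p13 (n : ℕ) (lam : TypeACrystal.Weight n)
    (hlam : TypeACrystal.IsDominant lam) :
    (∀ A : Set (TypeACrystal.Word n), TypeACrystal.IsLLAtom lam A →
      ∀ T ∈ A, ∀ T' ∈ A, TypeACrystal.atomicNumber T = TypeACrystal.atomicNumber T') ∧
    (∀ A : Set (TypeACrystal.Word n), TypeACrystal.IsOrbitComponent lam A →
      ∀ T ∈ A, ∀ T' ∈ A, TypeACrystal.atomicNumber T = TypeACrystal.atomicNumber T') := by
  constructor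
  · rintro A ⟨T₀, -, rfl⟩ T hT T' hT'
    rw [← TypeACrystal.atomicNumber_eq_of_LLEquiv hT.2,
      ← TypeACrystal.atomicNumber_eq_of_LLEquiv hT'.2]
  · rintro A ⟨T₀, -, rfl⟩ T hT T' hT'
    rw [← TypeACrystal.atomicNumber_eq_of_eqvGen
        (fun _ _ => TypeACrystal.atomicNumber_eq_of_orbitEdge) hT.2,
      ← TypeACrystal.atomicNumber_eq_of_eqvGen
        (fun _ _ => TypeACrystal.atomicNumber_eq_of_orbitEdge) hT'.2]
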